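/- Let $\mathcal M$ be a smooth Riemannian manifold (finite-dimensional, without boundary) with Riemannian distance $d_{\mathcal M}$, and suppose that $\mathcal M$ is geodesically complete: every geodesic (that is, every constant-speed, locally distance-minimizing curve) defined on an open interval extends to a geodesic defined on all of $\mathbb R$. Let $f:\mathcal M\times\mathbb R\to T\mathcal M$, $f(z,t)\in T_z\mathcal M$, be a time-dependent vector field which is $C^1$ (jointly in $(z,t)$) and bounded, i.e. there is $c\in\mathbb R$ with $\|f(z,t)\|_z\le c$ for all $z\in\mathcal M$, $t\in\mathbb R$. Then $f$ generates a global flow: there is a $C^1$ map $\phi:\mathcal M\times\mathbb R\to\mathcal M$ such that $$\phi(z,0)=z,\qquad \frac{\partial}{\partial t}\phi(z,t)=f(\phi(z,t),t)\qquad\text{for all } z\in\mathcal M,\ t\in\mathbb R.$$ It is the flow of $f$: every solution $\gamma:J\to\mathcal M$ of $\gamma'(t)=f(\gamma(t),t)$ on an open interval $J\ni 0$ satisfies $\gamma(t)=\phi(\gamma(0),t)$ for all $t\in J$. Moreover, for every $t\in\mathbb R$ the map $\phi(\cdot,t):\mathcal M\to\mathcal M$ is a $C^1$-diffeomorphism,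 i.e. a $C^1$ bijection with $C^1$ inverse. -/

import Mathlib

open scoped Bundle Manifold ContDiff NNReal

section Geodesic

/-- `γ` is a geodesic on the interval `J`: it has a constant speed `c`, and it is locally a shortest
path, i.e. every point of `J` has a neighbourhood in `J` on which the length `c * |s - s'|` of the
arc of `γ` between two parameters equals the distance of its end points. On a Riemannian manifold
the distance is the infimum of the lengths of curves. -/
def IsGeodesicOn {M : Type*} [EMetricSpace M] (γ : ℝ → M) (J : Set ℝ) : Prop :=
  ∃ c : ℝ≥0, ∀ t ∈ J, ∃ ε > 0, ∀ s ∈ J, ∀ s' ∈ J, |s - t| < ε → |s' - t| < ε →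
    edist (γ s) (γ s') = c * edist s s'

/-- Geodesic completeness: every geodesic on an open interval extends to a geodesic that is
defined for all times. -/
def GeodesicallyComplete (M : Type*) [EMetricSpace M] : Prop :=
  ∀ (γ : ℝ → M) (J : Set ℝ), IsOpen J → J.OrdConnected → IsGeodesicOn γ J →
    ∃ γ' : ℝ → M, IsGeodesicOn γ' Set.univ ∧ Set.EqOn γ' γ J

end Geodesic

section Flow

variable {E : Type*} [NormedAddCommGroup E] [NormedSpace ℝ E]
  {H : Type*} [TopologicalSpace H] (I : ModelWithCorners ℝ E H)
  {M : Type*} [TopologicalSpace M] [ChartedSpace H M]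

/-- The time-dependent vector field `f` is `C^1`, as a map `M × ℝ → TM`. -/
def IsC1TimeDependentField [IsManifold I 1 M] (f : (z : M) → ℝ → TangentSpace I z) : Prop :=
  ContMDiff (I.prod 𝓘(ℝ, ℝ)) I.tangent 1
    (fun p : M × ℝ ↦ (⟨p.1, f p.1 p.2⟩ : TangentBundle I M))

/-- `γ` solves `γ'(t) = f (γ t, t)` at all times of the open set `J`. -/
def SolvesOn (f : (z : M) → ℝ → TangentSpace I z) (γ : ℝ → M) (J : Set ℝ) : Prop :=
  ∀ t ∈ J, HasMFDerivAt 𝓘(ℝ, ℝ) I γ t ((1 : ℝ →L[ℝ] ℝ).smulRight (f (γ t) t))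

/-- `φ : M × ℝ → M` is a global `C^1` flow generated by the time-dependent vector field `f`. -/
structure IsGlobalFlow (f : (z : M) → ℝ → TangentSpace I z) (φ : M × ℝ → M) : Prop where
  contMDiff : ContMDiff (I.prod 𝓘(ℝ, ℝ)) I 1 φ
  map_zero : ∀ z, φ (z, 0) = z
  solves : ∀ z, SolvesOn I f (fun t ↦ φ (z, t)) Set.univ

end Flow

open Set Filter Topology Manifold MeasureTheory
open scoped ENNReal

/-- Any two points at finite distance are joined by curves that are, up to an arbitrarily small
error, parametrised by arc length and shortest. -/
def HasAlmostGeodesics (M : Type*) [EMetricSpace M] : Prop :=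
  ∀ p x : M, edist p x ≠ ⊤ → ∀ ε > 0, ∃ y : ℝ → M,
    (∀ t ∈ Icc 0 (edist p x).toReal, edist p (y t) = ENNReal.ofReal t ∧
      edist (y t) x ≤ ENNReal.ofReal ((edist p x).toReal - t + ε)) ∧
    ∀ s ∈ Icc 0 (edist p x).toReal, ∀ t ∈ Icc 0 (edist p x).toReal,
      edist (y s) (y t) ≤ ENNReal.ofReal (|s - t| + ε)

section Riemannian

variable {E : Type*} [NormedAddCommGroup E] [NormedSpace ℝ E]
  {H : Type*} [TopologicalSpace H] {I : ModelWithCorners ℝ E H}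
  {M : Type*} [EMetricSpace M] [ChartedSpace H M]
  [Bundle.RiemannianBundle (fun z : M ↦ TangentSpace I z)]
  [IsRiemannianManifold I M]

theorem edist_le_pathELength {γ : ℝ → M} {a b s t : ℝ} (hγ : ContMDiffOn 𝓘(ℝ, ℝ) I 1 γ (Icc a b))
    (has : a ≤ s) (hst : s ≤ t) (htb : t ≤ b) :
    edist (γ s) (γ t) ≤ pathELength I γ s t := by
  rw [IsRiemannianManifold.out (I := I)]
  exact riemannianEDist_le_pathELength (hγ.mono (Icc_subset_Icc has htb)) rfl rfl hst

theorem toReal_edist_add_le_of_path {c : ℝ → M} {r : ℝ}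
    (hc : ContMDiffOn 𝓘(ℝ, ℝ) I 1 c (Icc 0 1)) (hr : 0 ≤ r)
    (hlen : pathELength I c 0 1 ≤ ENNReal.ofReal r) {s t : ℝ} (h0 : 0 ≤ s) (hst : s ≤ t)
    (h1 : t ≤ 1) :
    edist (c 0) (c s) ≠ ⊤ ∧ edist (c s) (c t) ≠ ⊤ ∧ edist (c t) (c 1) ≠ ⊤ ∧
    (edist (c 0) (c s)).toReal + (edist (c s) (c t)).toReal + (edist (c t) (c 1)).toReal ≤ r := by
  have h : edist (c 0) (c s) + edist (c s) (c t) + edist (c t) (c 1) ≤ ENNReal.ofReal r := by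
    refine le_trans ?_ hlen
    rw [← pathELength_add (I := I) (γ := c) (h0.trans hst) h1, ← pathELength_add h0 hst]
    gcongr
    · exact edist_le_pathELength hc le_rfl h0 (hst.trans h1)
    · exact edist_le_pathELength hc h0 hst h1
    · exact edist_le_pathELength hc (h0.trans hst) h1 le_rfl
  have hne := ne_top_of_le_ne_top ENNReal.ofReal_ne_top h
  simp only [ne_eq, ENNReal.add_eq_top, not_or] at hne
  obtain ⟨⟨h2, h3⟩, h4⟩ := hne
  refine ⟨h2, h3, h4, ?_⟩
  rw [← ENNReal.toReal_add h2 h3, ← ENNReal.toReal_add (by simp [h2, h3]) h4]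
  exact ENNReal.toReal_le_of_le_ofReal hr h

theorem hasAlmostGeodesics_of_isRiemannianManifold
    {E : Type*} [NormedAddCommGroup E] [NormedSpace ℝ E]
    {H : Type*} [TopologicalSpace H] (I : ModelWithCorners ℝ E H)
    (M : Type*) [EMetricSpace M] [ChartedSpace H M]
    [Bundle.RiemannianBundle (fun z : M ↦ TangentSpace I z)]
    [IsRiemannianManifold I M] : HasAlmostGeodesics M := by
  intro p x hpx ε hε
  set r := (edist p x).toReal with hr
  have hr0 : 0 ≤ r := ENNReal.toReal_nonneg
  have hlt : riemannianEDist I p x < ENNReal.ofReal (r + ε) := by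
    rw [← IsRiemannianManifold.out (I := I), ← ENNReal.ofReal_toReal hpx]
    exact (ENNReal.ofReal_lt_ofReal_iff (by positivity)).2 (by linarith)
  obtain ⟨c, rfl, rfl, hc, hlen⟩ := exists_lt_of_riemannianEDist_lt hlt
  have key {s t : ℝ} := toReal_edist_add_le_of_path (s := s) (t := t) hc
    (add_nonneg hr0 hε.le) hlen.le
  have hcont : ContinuousOn (fun t ↦ (edist (c 0) (c t)).toReal) (Icc 0 1) := by
    intro t ht
    have h : ContinuousWithinAt (fun t ↦ edist (c 0) (c t)) (Icc 0 1) t :=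
      Tendsto.edist tendsto_const_nhds (hc.continuousOn t ht)
    exact (ENNReal.continuousAt_toReal (key ht.1 le_rfl ht.2).1).comp_continuousWithinAt
      (f := fun t ↦ edist (c 0) (c t)) h
  have hivt : ∀ t : ℝ, ∃ τ, t ∈ Icc 0 r → τ ∈ Icc (0 : ℝ) 1 ∧ (edist (c 0) (c τ)).toReal = t := by
    intro t
    by_cases ht : t ∈ Icc 0 r
    · obtain ⟨τ, hτ, h⟩ := intermediate_value_Icc zero_le_one hcont
        (by simpa [← hr] using ht : t ∈ Icc _ _)
      exact ⟨τ, fun _ ↦ ⟨hτ, h⟩⟩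
    · exact ⟨0, fun h ↦ absurd h ht⟩
  choose τ hτ using hivt
  have tri {u : ℝ} (hu : u ∈ Icc (0 : ℝ) 1) :
      r ≤ (edist (c 0) (c u)).toReal + (edist (c u) (c 1)).toReal := by
    have h := key hu.1 le_rfl hu.2
    rw [← ENNReal.toReal_add h.1 h.2.2.1]
    exact ENNReal.toReal_mono (by simp [h.1, h.2.2.1]) (edist_triangle _ _ _)
  have le {s t : ℝ} (hs : s ∈ Icc 0 r) (ht : t ∈ Icc 0 r) (h : τ s ≤ τ t) :
      edist (c (τ s)) (c (τ t)) ≤ ENNReal.ofReal (|s - t| + ε) := by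
    obtain ⟨h1, h2, h3, h4⟩ := key (hτ s hs).1.1 h (hτ t ht).1.2
    have h5 := tri (hτ t ht).1
    rw [(hτ s hs).2] at h4
    rw [(hτ t ht).2] at h5
    rw [← ENNReal.ofReal_toReal h2]
    refine ENNReal.ofReal_le_ofReal ?_
    have := neg_abs_le (s - t)
    linarith
  refine ⟨fun t ↦ c (τ t), fun t ht ↦ ⟨?_, ?_⟩, fun s hs t ht ↦ ?_⟩
  · obtain ⟨h1, h2⟩ := hτ t ht
    nth_rw 2 [← h2]
    rw [ENNReal.ofReal_toReal (key h1.1 le_rfl h1.2).1]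
  · obtain ⟨h1, h2⟩ := hτ t ht
    obtain ⟨-, h4, h5, h6⟩ := key h1.1 le_rfl h1.2
    rw [← ENNReal.ofReal_toReal h5]
    refine ENNReal.ofReal_le_ofReal ?_
    have : 0 ≤ (edist (c (τ t)) (c (τ t))).toReal := ENNReal.toReal_nonneg
    linarith
  · rcases le_total (τ s) (τ t) with h | h
    · exact le hs ht h
    · rw [edist_comm, abs_sub_comm]
      exact le ht hs h

end Riemannian

section HopfRinow

variable {M : Type*} [EMetricSpace M] {p : M} {R : ℝ}

theorem HasAlmostGeodesics.exists_isCompact_closedEBall_add [LocallyCompactSpace M]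
    (h : HasAlmostGeodesics M) (hR : 0 ≤ R)
    (hc : IsCompact (Metric.closedEBall p (ENNReal.ofReal R))) :
    ∃ ε > 0, IsCompact (Metric.closedEBall p (ENNReal.ofReal (R + ε))) := by
  obtain ⟨δ, hδ, hK⟩ := hc.exists_isCompact_cthickening
  refine ⟨δ / 2, by positivity, hK.of_isClosed_subset Metric.isClosed_closedEBall fun x hx ↦ ?_⟩
  rw [Metric.mem_closedEBall, edist_comm] at hx
  have hfin := ne_top_of_le_ne_top ENNReal.ofReal_ne_top hx
  have hx' := ENNReal.toReal_le_of_le_ofReal (by positivity) hx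
  by_cases hxR : (edist p x).toReal ≤ R
  · refine Metric.self_subset_cthickening _ ?_
    rw [Metric.mem_closedEBall, edist_comm, ← ENNReal.ofReal_toReal hfin]
    exact ENNReal.ofReal_le_ofReal hxR
  · obtain ⟨y, hy, -⟩ := h p x hfin (δ / 2) (by positivity)
    obtain ⟨h1, h2⟩ := hy R ⟨hR, (not_le.1 hxR).le⟩
    refine Metric.mem_cthickening_of_edist_le x (y R) δ _ ?_ ?_
    · rw [Metric.mem_closedEBall, edist_comm, h1]
    · rw [edist_comm]
      exact h2.trans (ENNReal.ofReal_le_ofReal (by linarith))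

theorem isGeodesicOn_of_edist_eq {γ : ℝ → M} {J : Set ℝ}
    (h : ∀ s ∈ J, ∀ t ∈ J, edist (γ s) (γ t) = ENNReal.ofReal |s - t|) : IsGeodesicOn γ J := by
  refine ⟨1, fun t ht ↦ ⟨1, one_pos, fun s hs s' hs' _ _ ↦ ?_⟩⟩
  rw [h s hs s' hs', edist_dist, Real.dist_eq]
  simp

theorem IsGeodesicOn.continuous {γ : ℝ → M} (h : IsGeodesicOn γ univ) : Continuous γ := by
  obtain ⟨c, hc⟩ := h
  refine continuous_iff_continuousAt.2 fun t ↦ ?_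
  obtain ⟨ε, hε, h⟩ := hc t (mem_univ _)
  rw [ContinuousAt, tendsto_iff_edist_tendsto_0]
  have hlim : Tendsto (fun s ↦ (c : ℝ≥0∞) * edist s t) (𝓝 t) (𝓝 0) := by
    have : Tendsto (fun s ↦ edist s t) (𝓝 t) (𝓝 0) := by
      simpa using (continuous_id.edist (continuous_const (y := t))).tendsto t
    simpa using ENNReal.Tendsto.const_mul this (Or.inr ENNReal.coe_ne_top)
  refine hlim.congr' ?_
  filter_upwards [Metric.ball_mem_nhds t hε] with s hs
  exact (h s (mem_univ _) t (mem_univ _) (by simpa [Real.dist_eq] using hs) (by simpa)).symm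

/-- In a geodesically complete length space, a limit along an ultrafilter of almost shortest
curves from `p` is a geodesic; its end point is the limit of the end points. -/
theorem exists_tendsto_of_almostGeodesics (hM : GeodesicallyComplete M) (hR : 0 < R)
    (hc : ∀ r < R, IsCompact (Metric.closedEBall p (ENNReal.ofReal r)))
    {U : Ultrafilter ℕ} {x : ℕ → M} {r ε : ℕ → ℝ} {y : ℕ → ℝ → M}
    (hr : Tendsto r U (𝓝 R)) (hε : Tendsto ε U (𝓝 0))
    (hy : ∀ n, ∀ t ∈ Icc 0 (r n), edist p (y n t) = ENNReal.ofReal t ∧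
      edist (y n t) (x n) ≤ ENNReal.ofReal (r n - t + ε n))
    (hyy : ∀ n, ∀ s ∈ Icc 0 (r n), ∀ t ∈ Icc 0 (r n),
      edist (y n s) (y n t) ≤ ENNReal.ofReal (|s - t| + ε n)) :
    ∃ q, Tendsto x U (𝓝 q) := by
  have hev {t : ℝ} (ht : t ∈ Ico 0 R) : ∀ᶠ n in (U : Filter ℕ), t ∈ Icc 0 (r n) :=
    (hr.eventually (lt_mem_nhds ht.2)).mono fun n hn ↦ ⟨ht.1, hn.le⟩
  have hlim : ∀ t : ℝ, ∃ q, t ∈ Ico 0 R → Tendsto (fun n ↦ y n t) U (𝓝 q) := by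
    intro t
    by_cases ht : t ∈ Ico 0 R
    · have hmem : Metric.closedEBall p (ENNReal.ofReal t) ∈ U.map (fun n ↦ y n t) := by
        refine Ultrafilter.mem_map.2 (Filter.mem_of_superset (hev ht) fun n hn ↦ ?_)
        rw [mem_preimage, Metric.mem_closedEBall, edist_comm, (hy n t hn).1]
      obtain ⟨q, -, hq⟩ := (hc t ht.2).ultrafilter_le_nhds' _ hmem
      exact ⟨q, fun _ ↦ hq⟩
    · exact ⟨p, fun h ↦ absurd h ht⟩
  choose γ hγ using hlim
  have hgeo : ∀ s ∈ Ioo 0 R, ∀ t ∈ Ioo 0 R, edist (γ s) (γ t) = ENNReal.ofReal |s - t| := by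
    intro s hs t ht
    replace hs := Ioo_subset_Ico_self hs
    replace ht := Ioo_subset_Ico_self ht
    refine tendsto_nhds_unique ((hγ s hs).edist (hγ t ht)) ?_
    refine tendsto_of_tendsto_of_tendsto_of_le_of_le' (g := fun _ ↦ ENNReal.ofReal |s - t|)
      (h := fun n ↦ ENNReal.ofReal (|s - t| + ε n)) tendsto_const_nhds ?_ ?_ ?_
    · refine (ENNReal.continuous_ofReal.tendsto _).comp ?_
      simpa using tendsto_const_nhds.add hε
    · filter_upwards [hev hs, hev ht] with n hns hnt
      have aux {a b : ℝ} (ha : a ∈ Icc 0 (r n)) (hb : b ∈ Icc 0 (r n)) :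
          ENNReal.ofReal (b - a) ≤ edist (y n a) (y n b) := by
        have := edist_triangle p (y n a) (y n b)
        rw [(hy n a ha).1, (hy n b hb).1] at this
        rw [ENNReal.ofReal_sub _ ha.1]
        exact tsub_le_iff_left.2 this
      rcases abs_cases (s - t) with h | h
      · rw [h.1, edist_comm]
        exact aux hnt hns
      · rw [h.1, neg_sub]
        exact aux hns hnt
    · filter_upwards [hev hs, hev ht] with n hns hnt using hyy n s hns t hnt
  obtain ⟨γ', hγ', heq⟩ := hM γ (Ioo 0 R) isOpen_Ioo ordConnected_Ioo (isGeodesicOn_of_edist_eq hgeo)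
  refine ⟨γ' R, ?_⟩
  rw [EMetric.tendsto_nhds]
  intro δ hδ
  have hδ3 : 0 < δ / 3 := ENNReal.div_pos hδ.ne' (by simp)
  have hlimR : Tendsto (fun t ↦ edist (γ' t) (γ' R)) (𝓝[<] R) (𝓝 0) := by
    rw [← tendsto_iff_edist_tendsto_0]
    exact hγ'.continuous.continuousWithinAt
  have hlimR' : Tendsto (fun t ↦ ENNReal.ofReal (R - t)) (𝓝[<] R) (𝓝 0) := by
    have : Continuous fun t ↦ ENNReal.ofReal (R - t) :=
      ENNReal.continuous_ofReal.comp (continuous_const.sub continuous_id)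
    simpa using (this.tendsto R).mono_left nhdsWithin_le_nhds
  obtain ⟨t, ht, ht1, ht2⟩ := ((Filter.Eventually.and (Ioo_mem_nhdsLT hR)
    ((hlimR.eventually (gt_mem_nhds hδ3)).and (hlimR'.eventually (gt_mem_nhds hδ3))))).exists
  have ht' := Ioo_subset_Ico_self ht
  have hend : Tendsto (fun n ↦ ENNReal.ofReal (r n - t + ε n)) U (𝓝 (ENNReal.ofReal (R - t))) := by
    refine (ENNReal.continuous_ofReal.tendsto _).comp ?_
    simpa using (hr.sub_const t).add hε
  filter_upwards [hev ht', hend.eventually (gt_mem_nhds ht2),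
    EMetric.tendsto_nhds.1 (hγ t ht') _ hδ3] with n h1 h2 h3
  calc edist (x n) (γ' R) ≤ edist (x n) (y n t) + edist (y n t) (γ t) + edist (γ t) (γ' R) :=
        edist_triangle4 _ _ _ _
    _ < δ / 3 + δ / 3 + δ / 3 := by
        refine ENNReal.add_lt_add (ENNReal.add_lt_add ?_ h3) ?_
        · rw [edist_comm]
          exact ((hy n t h1).2).trans_lt h2
        · rwa [← heq ht]
    _ = δ := ENNReal.add_thirds δ

theorem HasAlmostGeodesics.isCompact_closedEBall_of_forall_lt (h : HasAlmostGeodesics M)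
    (hM : GeodesicallyComplete M) (hR : 0 < R)
    (hc : ∀ r < R, IsCompact (Metric.closedEBall p (ENNReal.ofReal r))) :
    IsCompact (Metric.closedEBall p (ENNReal.ofReal R)) := by
  refine IsSeqCompact.isCompact ?_
  intro x hx
  have hx' n : edist p (x n) ≤ ENNReal.ofReal R := by
    simpa [edist_comm] using hx n
  have hfin n : edist p (x n) ≠ ⊤ := ne_top_of_le_ne_top ENNReal.ofReal_ne_top (hx' n)
  by_cases hr : ∀ r < R, ∀ᶠ n in atTop, r < (edist p (x n)).toReal
  · have hlim : Tendsto (fun n ↦ (edist p (x n)).toReal) atTop (𝓝 R) := by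
      refine tendsto_order.2 ⟨hr, fun r hr ↦ .of_forall fun n ↦ ?_⟩
      exact (ENNReal.toReal_le_of_le_ofReal hR.le (hx' n)).trans_lt hr
    choose y hy hyy using fun n : ℕ ↦ h p (x n) (hfin n) (1 / ((n : ℝ) + 1)) (by positivity)
    have hU : ((hyperfilter ℕ : Ultrafilter ℕ) : Filter ℕ) ≤ atTop := Nat.hyperfilter_le_atTop
    obtain ⟨q, hq⟩ := exists_tendsto_of_almostGeodesics hM hR hc (hlim.mono_left hU)
      (tendsto_one_div_add_atTop_nhds_zero_nat.mono_left hU) hy hyy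
    have hcl : MapClusterPt q atTop x := (hq.mapClusterPt).mono hU
    obtain ⟨φ, hφ, hlim⟩ := hcl.tendsto_subseq
    exact ⟨q, Metric.isClosed_closedEBall.mem_of_tendsto hlim (.of_forall fun n ↦ hx _), φ, hφ,
      hlim⟩
  · push Not at hr
    obtain ⟨r, hrR, hfreq⟩ := hr
    obtain ⟨q, hq, φ, hφ, hlim⟩ := (hc r hrR).tendsto_subseq' (x := x) (hfreq.mono fun n hn ↦ by
      rw [Metric.mem_closedEBall, edist_comm, ← ENNReal.ofReal_toReal (hfin n)]
      exact ENNReal.ofReal_le_ofReal hn)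
    exact ⟨q, Metric.isClosed_closedEBall.mem_of_tendsto hlim (.of_forall fun n ↦ hx _), φ, hφ,
      hlim⟩

/-- **Hopf–Rinow theorem**, in the generality of locally compact length spaces: if geodesics
extend indefinitely, then closed balls of finite radius are compact. -/
theorem HasAlmostGeodesics.isCompact_closedEBall [LocallyCompactSpace M]
    (h : HasAlmostGeodesics M) (hM : GeodesicallyComplete M) (p : M) (R : ℝ) :
    IsCompact (Metric.closedEBall p (ENNReal.ofReal R)) := by
  set S := {r : ℝ | IsCompact (Metric.closedEBall p (ENNReal.ofReal r))} with hS
  have hdown {r r' : ℝ} (hr : r ∈ S) (hle : r' ≤ r) : r' ∈ S :=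
    IsCompact.of_isClosed_subset hr Metric.isClosed_closedEBall
      (Metric.closedEBall_subset_closedEBall (ENNReal.ofReal_le_ofReal hle))
  by_contra hR
  have hbdd : BddAbove S := ⟨R, fun r hr ↦ le_of_not_ge fun hle ↦ hR (hdown hr hle)⟩
  have h0 : (0 : ℝ) ∈ S := by simp [hS]
  have hsup0 : 0 ≤ sSup S := le_csSup hbdd h0
  have hsup : sSup S ∈ S := by
    rcases hsup0.eq_or_lt with heq | hlt
    · rwa [← heq]
    · refine h.isCompact_closedEBall_of_forall_lt hM hlt fun r hr ↦ ?_
      obtain ⟨r', hr', hlt'⟩ := exists_lt_of_lt_csSup ⟨0, h0⟩ hr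
      exact hdown hr' hlt'.le
  obtain ⟨ε, hε, hmem⟩ := h.exists_isCompact_closedEBall_add hsup0 hsup
  have := le_csSup hbdd (show sSup S + ε ∈ S from hmem)
  linarith

end HopfRinow

section Nemytskii

variable {K E F : Type*} [TopologicalSpace K] [CompactSpace K]
  [NormedAddCommGroup E] [NormedSpace ℝ E] [NormedAddCommGroup F] [NormedSpace ℝ F]

namespace ContinuousMap

/-- Pointwise application of a continuous family of continuous linear maps. -/
noncomputable def applyCLM (A : C(K, E →L[ℝ] F)) : C(K, E) →L[ℝ] C(K, F) :=
  LinearMap.mkContinuousOfExistsBound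
    { toFun := fun h ↦ ⟨fun t ↦ A t (h t), A.continuous.clm_apply h.continuous⟩
      map_add' := fun _ _ ↦ by ext; simp
      map_smul' := fun _ _ ↦ by ext; simp } <| by
    obtain ⟨C, hC⟩ := (isCompact_range A.continuous).isBounded.exists_norm_le
    refine ⟨max C 0, fun h ↦ (ContinuousMap.norm_le _ (by positivity)).2 fun t ↦ ?_⟩
    exact (A t).le_of_opNorm_le_of_le ((hC _ (mem_range_self t)).trans (le_max_left _ _))
      (h.norm_coe_le_norm t)

theorem continuous_applyCLM :
    Continuous (applyCLM : C(K, E →L[ℝ] F) → C(K, E) →L[ℝ] C(K, F)) := by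
  let inst := ContinuousMap.instPseudoMetricSpace K (E →L[ℝ] F)
  let := inst.toPseudoEMetricSpace
  refine LipschitzWith.continuous (K := 1) (LipschitzWith.of_dist_le_mul fun A B ↦ ?_)
  rw [NNReal.coe_one, one_mul, dist_eq_norm]
  refine ContinuousLinearMap.opNorm_le_bound _ dist_nonneg fun h ↦ ?_
  refine (ContinuousMap.norm_le _ (by positivity)).2 fun t ↦ ?_
  refine ContinuousLinearMap.le_of_opNorm_le_of_le (A t - B t) ?_ (h.norm_coe_le_norm t)
  rw [← dist_eq_norm]
  exact ContinuousMap.dist_apply_le_dist t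

end ContinuousMap

/-- A compactly supported `C^1` map acts by composition as a `C^1` map on the space of continuous
functions on a compact space. -/
theorem ContDiff.contDiff_comp_continuousMap {v : C(E, F)} (hv : ContDiff ℝ 1 v)
    (hsupp : HasCompactSupport v) : ContDiff ℝ 1 (fun u : C(K, E) ↦ v.comp u) := by
  have hcont : Continuous (fderiv ℝ v) := hv.continuous_fderiv one_ne_zero
  have hunif : UniformContinuous (fderiv ℝ v) :=
    (hsupp.fderiv ℝ).uniformContinuous_of_continuous hcont
  rw [contDiff_one_iff_hasFDerivAt]
  refine ⟨fun u ↦ ContinuousMap.applyCLM (ContinuousMap.comp ⟨fderiv ℝ v, hcont⟩ u), ?_, fun u ↦ ?_⟩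
  · exact ContinuousMap.continuous_applyCLM.comp (ContinuousMap.continuous_postcomp _)
  · rw [hasFDerivAt_iff_isLittleO_nhds_zero, Asymptotics.isLittleO_iff]
    intro c hc
    obtain ⟨δ, hδ, h⟩ := Metric.uniformContinuous_iff.1 hunif c hc
    filter_upwards [Metric.ball_mem_nhds (0 : C(K, E)) hδ] with k hk
    rw [mem_ball_zero_iff] at hk
    refine (ContinuousMap.norm_le _ (by positivity)).2 fun t ↦ ?_
    have hkt : ‖k t‖ ≤ ‖k‖ := k.norm_coe_le_norm t
    have := (convex_ball (u t) δ).norm_image_sub_le_of_norm_fderiv_le' (𝕜 := ℝ)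
      (f := v) (φ := fderiv ℝ v (u t)) (C := c) (x := u t) (y := u t + k t)
      (fun x _ ↦ (hv.differentiable one_ne_zero) x)
      (fun x hx ↦ by rw [← dist_eq_norm]; exact (h hx).le) (Metric.mem_ball_self hδ)
      (by simpa using hkt.trans_lt hk)
    simp only [add_sub_cancel_left] at this
    exact this.trans (by gcongr)

end Nemytskii

section Primitive

variable {E : Type*} [NormedAddCommGroup E] [NormedSpace ℝ E]

namespace ContinuousMap

/-- The primitive vanishing at `0` of a continuous function on `[0, 1]`. -/
noncomputable def primitiveCLM : C(Icc (0 : ℝ) 1, E) →L[ℝ] C(Icc (0 : ℝ) 1, E) :=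
  LinearMap.mkContinuous
    { toFun := fun u ↦ ⟨fun t ↦ ∫ τ in (0 : ℝ)..t, IccExtend zero_le_one u τ,
        (intervalIntegral.continuous_primitive
          (fun a b ↦ (u.continuous.Icc_extend').intervalIntegrable a b) 0).comp
          continuous_subtype_val⟩
      map_add' := fun u w ↦ by
        ext t
        exact intervalIntegral.integral_add (u.continuous.Icc_extend'.intervalIntegrable _ _)
          (w.continuous.Icc_extend'.intervalIntegrable _ _)
      map_smul' := fun c u ↦ by
        ext t
        exact intervalIntegral.integral_smul c _ } 1 fun u ↦ by
    rw [one_mul]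
    refine (ContinuousMap.norm_le _ (norm_nonneg _)).2 fun t ↦ ?_
    refine (intervalIntegral.norm_integral_le_of_norm_le_const (C := ‖u‖)
      fun τ _ ↦ u.norm_coe_le_norm _).trans ?_
    rw [sub_zero, abs_of_nonneg t.2.1]
    exact mul_le_of_le_one_right (norm_nonneg _) t.2.2

end ContinuousMap

end Primitive

section LocalFlow

variable {E : Type*} [NormedAddCommGroup E] [NormedSpace ℝ E] [CompleteSpace E]

/-- The equation `u t = x + s * ∫₀ᵗ v (u τ) dτ` on `[0, 1]` has, near `s = 0`, a solution
that depends on `(x, s)` in a `C^1` way. -/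
theorem exists_contDiffAt_solution_integral_equation {v : C(E, E)} (hv : ContDiff ℝ 1 v)
    (hsupp : HasCompactSupport v) (x₀ : E) :
    ∃ h : E × ℝ → C(Icc (0 : ℝ) 1, E), ContDiffAt ℝ 1 h (x₀, 0) ∧ ∀ᶠ p in 𝓝 (x₀, (0 : ℝ)),
      ∀ t, h p t = p.1 + p.2 • ContinuousMap.primitiveCLM (v.comp (h p)) t := by
  let G : (E × ℝ) × C(Icc (0 : ℝ) 1, E) → C(Icc (0 : ℝ) 1, E) := fun q ↦
    q.2 - ContinuousLinearMap.const ℝ (Icc (0 : ℝ) 1) q.1.1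
      - q.1.2 • ContinuousMap.primitiveCLM (v.comp q.2)
  have hG : ContDiff ℝ 1 G := by
    have h1 : ContDiff ℝ 1 fun q : (E × ℝ) × C(Icc (0 : ℝ) 1, E) ↦ v.comp q.2 :=
      (hv.contDiff_comp_continuousMap hsupp).comp contDiff_snd
    fun_prop
  let u₀ : (E × ℝ) × C(Icc (0 : ℝ) 1, E) := ((x₀, 0), ContinuousLinearMap.const ℝ _ x₀)
  have hinv : fderiv ℝ G u₀ ∘L .inr ℝ (E × ℝ) C(Icc (0 : ℝ) 1, E) = .id ℝ _ := by
    have h1 : HasFDerivAt (fun w ↦ G (u₀.1, w)) (fderiv ℝ G u₀ ∘L .inr ℝ (E × ℝ) _) u₀.2 :=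
      ((hG.differentiable one_ne_zero) u₀).hasFDerivAt.comp u₀.2 (hasFDerivAt_prodMk_right _ _)
    have h2 : HasFDerivAt (fun w ↦ G (u₀.1, w)) (.id ℝ _) u₀.2 := by
      simpa [G, u₀] using (hasFDerivAt_id u₀.2).sub_const (ContinuousLinearMap.const ℝ _ x₀)
    exact h1.unique h2
  have hinv' : (fderiv ℝ G u₀ ∘L .inr ℝ (E × ℝ) C(Icc (0 : ℝ) 1, E)).IsInvertible := by
    rw [hinv]
    exact ⟨.refl ℝ _, rfl⟩
  refine ⟨hG.contDiffAt.implicitFunction one_ne_zero hinv',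
    hG.contDiffAt.contDiffAt_implicitFunction one_ne_zero hinv', ?_⟩
  filter_upwards [hG.contDiffAt.eventually_apply_implicitFunction one_ne_zero hinv'] with p hp t
  have h0 : G u₀ = 0 := by simp [G, u₀]
  have := DFunLike.congr_fun (hp.trans h0) t
  simp only [G, ContinuousMap.sub_apply, ContinuousMap.smul_apply, ContinuousMap.zero_apply,
    ContinuousLinearMap.const_apply_apply] at this
  rw [sub_eq_zero, sub_eq_iff_eq_add'] at this
  exact this

theorem contDiffAt_localFlow_of_hasCompactSupport {v : C(E, E)} (hv : ContDiff ℝ 1 v)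
    (hsupp : HasCompactSupport v) {x₀ : E} {α : E → ℝ → E}
    (hα : ∀ᶠ p in 𝓝 x₀ ×ˢ 𝓝 (0 : ℝ), α p.1 0 = p.1 ∧ HasDerivAt (α p.1) (v (α p.1 p.2)) p.2) :
    ContDiffAt ℝ 1 (fun p : E × ℝ ↦ α p.1 p.2) (x₀, 0) := by
  obtain ⟨h, hh, heq⟩ := exists_contDiffAt_solution_integral_equation hv hsupp x₀
  obtain ⟨K, hK⟩ := hv.lipschitzWith_of_hasCompactSupport hsupp one_ne_zero
  have h1 : ContDiffAt ℝ 1 (fun p ↦ h p ⟨1, by simp⟩) (x₀, 0) :=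
    (ContinuousMap.evalCLM (M := E) ℝ
      (⟨1, by simp⟩ : Icc (0 : ℝ) 1)).contDiff.contDiffAt.comp (x₀, 0) hh
  refine h1.congr_of_eventuallyEq ?_
  obtain ⟨U, hU, V, hV, hUV⟩ := Filter.mem_prod_iff.1 hα
  obtain ⟨ε, hε, hεV⟩ := Metric.mem_nhds_iff.1 hV
  filter_upwards [heq, prod_mem_nhds hU (Metric.ball_mem_nhds (0 : ℝ) hε)] with p hp hpU
  have hmem {t : ℝ} (ht : t ∈ Icc (0 : ℝ) 1) : (p.1, p.2 * t) ∈ U ×ˢ V := by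
    refine ⟨hpU.1, hεV ?_⟩
    have := hpU.2
    rw [mem_ball_zero_iff, Real.norm_eq_abs] at this ⊢
    rw [abs_mul, abs_of_nonneg ht.1]
    exact (mul_le_of_le_one_right (abs_nonneg _) ht.2).trans_lt this
  let F : ℝ → E := fun t ↦ p.1 + p.2 • ∫ τ in (0 : ℝ)..t, v (IccExtend zero_le_one (h p) τ)
  have hF (t : ℝ) (ht : t ∈ Icc (0 : ℝ) 1) : F t = IccExtend zero_le_one (h p) t := by
    rw [IccExtend_of_mem _ _ ht, hp]
    rfl
  have hFd (t : ℝ) (ht : t ∈ Icc (0 : ℝ) 1) : HasDerivAt F (p.2 • v (F t)) t := by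
    rw [hF t ht]
    have hc : Continuous fun τ ↦ v (IccExtend zero_le_one (h p) τ) :=
      v.continuous.comp (h p).continuous.Icc_extend'
    exact ((hc.integral_hasStrictDerivAt 0 t).hasDerivAt.const_smul p.2).const_add p.1
  have hgd (t : ℝ) (ht : t ∈ Icc (0 : ℝ) 1) :
      HasDerivAt (fun t ↦ α p.1 (p.2 * t)) (p.2 • v (α p.1 (p.2 * t))) t := by
    have h2 : HasDerivAt (fun t ↦ p.2 * t) p.2 t := by
      simpa using (hasDerivAt_id t).const_mul p.2
    exact (hUV (hmem ht)).2.scomp t h2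
  have key : EqOn (fun t ↦ α p.1 (p.2 * t)) F (Icc 0 1) := by
    refine ODE_solution_unique (v := fun _ x ↦ p.2 • v x) (K := ‖p.2‖₊ * K)
      (fun _ ↦ (lipschitzWith_smul p.2).comp hK)
      (fun t ht ↦ (hgd t ht).continuousAt.continuousWithinAt)
      (fun t ht ↦ (hgd t (Ico_subset_Icc_self ht)).hasDerivWithinAt)
      (fun t ht ↦ (hFd t ht).continuousAt.continuousWithinAt)
      (fun t ht ↦ (hFd t (Ico_subset_Icc_self ht)).hasDerivWithinAt) ?_
    have h3 := (hUV (hmem (t := 0) (by simp))).1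
    simpa [F] using h3
  have h4 := key (right_mem_Icc.2 zero_le_one)
  rw [hF 1 (by simp), IccExtend_of_mem _ _ (by simp : (1 : ℝ) ∈ Icc 0 1)] at h4
  simpa using h4

end LocalFlow

/-- A vector field that is `C^1` near `x₀` has a local flow that is `C^1` near `(x₀, 0)`. -/
theorem ContDiffAt.exists_contDiffAt_localFlow
    {E : Type*} [NormedAddCommGroup E] [NormedSpace ℝ E] [FiniteDimensional ℝ E] {v : E → E} {x₀ : E}
    (hv : ContDiffAt ℝ 1 v x₀) :
    ∃ α : E → ℝ → E, ContDiffAt ℝ 1 (fun p : E × ℝ ↦ α p.1 p.2) (x₀, 0) ∧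
      ∀ᶠ p in 𝓝 x₀ ×ˢ 𝓝 (0 : ℝ), α p.1 0 = p.1 ∧ HasDerivAt (α p.1) (v (α p.1 p.2)) p.2 := by
  have : CompleteSpace E := FiniteDimensional.complete ℝ E
  obtain ⟨U, hU, hvU⟩ := hv.contDiffOn le_rfl (by simp)
  obtain ⟨r, hr, hrU⟩ := Metric.mem_nhds_iff.1 hU
  let χ : ContDiffBump x₀ := ⟨r / 4, r / 2, by positivity, by linarith⟩
  have hw : ContDiff ℝ 1 fun x ↦ χ x • v x := by
    refine contDiff_iff_contDiffAt.2 fun x ↦ ?_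
    by_cases hx : x ∈ Metric.ball x₀ r
    · exact χ.contDiffAt.smul (hvU.contDiffAt (mem_of_superset (Metric.isOpen_ball.mem_nhds hx) hrU))
    · have hx' : x ∈ (tsupport χ)ᶜ := by
        rw [χ.tsupport_eq]
        intro h
        exact hx (Metric.closedBall_subset_ball (by simp [χ]; linarith) h)
      refine (contDiffAt_const (c := (0 : E))).congr_of_eventuallyEq ?_
      filter_upwards [(isClosed_tsupport χ).isOpen_compl.mem_nhds hx'] with y hy
      rw [image_eq_zero_of_notMem_tsupport hy, zero_smul]
  have hsupp : HasCompactSupport fun x ↦ χ x • v x := χ.hasCompactSupport.smul_right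
  obtain ⟨α, hα⟩ := hw.contDiffAt.exists_eventually_eq_hasDerivAt (x₀ := x₀) 0
  have hαd := contDiffAt_localFlow_of_hasCompactSupport (v := ⟨_, hw.continuous⟩) hw hsupp hα
  refine ⟨α, hαd, ?_⟩
  rw [← nhds_prod_eq] at hα ⊢
  have h0 : α x₀ 0 = x₀ := (hα.self_of_nhds).1
  have hχ : ∀ᶠ p : E × ℝ in 𝓝 (x₀, 0), χ (α p.1 p.2) = 1 := by
    have := hαd.continuousAt.tendsto
    simp only [h0] at this
    exact this.eventually χ.eventuallyEq_one
  filter_upwards [hα, hχ] with p hp hp'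
  simpa [hp'] using hp

section ManifoldFlow

variable {E : Type*} [NormedAddCommGroup E] [NormedSpace ℝ E]
  {H : Type*} [TopologicalSpace H] {I : ModelWithCorners ℝ E H}
  {M : Type*} [TopologicalSpace M] [ChartedSpace H M] [IsManifold I 1 M]
  {v : (x : M) → TangentSpace I x}

/-- A solution of the equation of integral curves in a chart is an integral curve. -/
theorem hasMFDerivAt_extChartAt_symm_comp {x₀ : M} {f : ℝ → E} {t : ℝ}
    (hd : HasDerivAt f (tangentCoordChange I ((extChartAt I x₀).symm (f t)) x₀
      ((extChartAt I x₀).symm (f t)) (v ((extChartAt I x₀).symm (f t)))) t)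
    (hf : f t ∈ interior (extChartAt I x₀).target) :
    HasMFDerivAt 𝓘(ℝ, ℝ) I ((extChartAt I x₀).symm ∘ f) t
      ((1 : ℝ →L[ℝ] ℝ).smulRight (v (((extChartAt I x₀).symm ∘ f) t))) := by
  let xₜ : M := (extChartAt I x₀).symm (f t)
  have h : HasDerivAt f (tangentCoordChange I xₜ x₀ xₜ (v xₜ)) t := hd
  have hf' := interior_subset hf
  have hft1 := mem_preimage.mp <|
    mem_of_mem_of_subset hf' (extChartAt I x₀).target_subset_preimage_source
  have hft2 := mem_extChartAt_source (I := I) xₜ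
  have hv (w : E) : tangentCoordChange I x₀ xₜ xₜ (tangentCoordChange I xₜ x₀ xₜ w) = w := by
    rw [tangentCoordChange_comp ⟨⟨hft2, hft1⟩, hft2⟩, tangentCoordChange_self hft2]
  have key : HasDerivAt ((extChartAt I xₜ ∘ (extChartAt I x₀).symm) ∘ f) (v xₜ : E) t := by
    refine (?_ : HasDerivAt _ _ t).congr_deriv (hv (v xₜ))
    apply HasFDerivAt.comp_hasDerivAt _ _ h
    apply HasFDerivWithinAt.hasFDerivAt (s := range I) _ <|
      mem_nhds_iff.mpr ⟨interior (extChartAt I x₀).target,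
        subset_trans interior_subset (extChartAt_target_subset_range ..),
        isOpen_interior, hf⟩
    rw [← (extChartAt I x₀).right_inv hf']
    exact hasFDerivWithinAt_tangentCoordChange ⟨hft1, hft2⟩
  refine ⟨(continuousAt_extChartAt_symm'' hf').comp h.continuousAt, ?_⟩
  exact key.hasFDerivAt.hasFDerivWithinAt

variable [FiniteDimensional ℝ E] [BoundarylessManifold I M]

/-- A `C^1` vector field on a manifold has, near every point, a `C^1` local flow. -/
theorem exists_contMDiffAt_localFlow {x₀ : M}
    (hv : ContMDiffAt I I.tangent 1 (fun x ↦ (⟨x, v x⟩ : TangentBundle I M)) x₀) :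
    ∃ ψ : M × ℝ → M, ContMDiffAt (I.prod 𝓘(ℝ, ℝ)) I 1 ψ (x₀, 0) ∧
      ∃ U ∈ 𝓝 x₀, ∃ ε > 0, ∀ x ∈ U, ψ (x, 0) = x ∧
        IsMIntegralCurveOn (fun t ↦ ψ (x, t)) v (Ioo (-ε) ε) := by
  rw [contMDiffAt_iff] at hv
  obtain ⟨_, hv⟩ := hv
  have hx : I.IsInteriorPoint x₀ := BoundarylessManifold.isInteriorPoint
  obtain ⟨α, hα, hflow⟩ := (hv.contDiffAt
    (range_mem_nhds_isInteriorPoint hx)).snd.exists_contDiffAt_localFlow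
  set e := extChartAt I x₀ with he
  rw [← nhds_prod_eq] at hflow
  have h0 : α (e x₀) 0 = e x₀ := hflow.self_of_nhds.1
  have htarget : ∀ᶠ p : E × ℝ in 𝓝 (e x₀, 0), α p.1 p.2 ∈ interior e.target := by
    have h := hα.continuousAt.tendsto
    simp only [h0] at h
    exact h.eventually (isOpen_interior.mem_nhds ((I.isInteriorPoint_iff).mp hx))
  obtain ⟨V, hV, W, hW, hVW⟩ := mem_nhds_prod_iff.1 (hflow.and htarget)
  obtain ⟨ε, hε, hεW⟩ := Metric.mem_nhds_iff.1 hW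
  rw [Real.ball_eq_Ioo, zero_sub, zero_add] at hεW
  refine ⟨fun p ↦ e.symm (α (e p.1) p.2), ?_, e ⁻¹' V ∩ e.source, inter_mem
    ((continuousAt_extChartAt x₀).preimage_mem_nhds hV) (extChartAt_source_mem_nhds x₀), ε, hε,
    fun x hx ↦ ⟨?_, ?_⟩⟩
  · have h1 : ContMDiffAt (I.prod 𝓘(ℝ, ℝ)) 𝓘(ℝ, E) 1 (fun p : M × ℝ ↦ e p.1) (x₀, 0) :=
      (contMDiffAt_extChartAt (I := I) (n := 1) (x := x₀)).comp (x₀, (0 : ℝ)) contMDiffAt_fst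
    have h2 : ContMDiffAt (I.prod 𝓘(ℝ, ℝ)) 𝓘(ℝ, E × ℝ) 1 (fun p : M × ℝ ↦ (e p.1, p.2)) (x₀, 0) :=
      h1.prodMk_space contMDiffAt_snd
    have h3 : ContMDiffAt (I.prod 𝓘(ℝ, ℝ)) 𝓘(ℝ, E) 1 (fun p : M × ℝ ↦ α (e p.1) p.2) (x₀, 0) :=
      ContMDiffAt.comp (x₀, (0 : ℝ)) (g := fun p : E × ℝ ↦ α p.1 p.2) hα.contMDiffAt h2
    have h4 : ContMDiffAt 𝓘(ℝ, E) I 1 e.symm (α (e x₀) 0) := by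
      rw [h0]
      refine (contMDiffOn_extChartAt_symm x₀).contMDiffAt ?_
      exact mem_of_superset (isOpen_interior.mem_nhds ((I.isInteriorPoint_iff).mp hx))
        interior_subset
    exact ContMDiffAt.comp (x₀, (0 : ℝ)) (g := e.symm) h4 h3
  · have := (hVW (mk_mem_prod hx.1 (mem_of_mem_nhds hW))).1.1
    simp only [this]
    exact e.left_inv hx.2
  · intro t ht
    obtain ⟨⟨-, h1⟩, h2⟩ := hVW (mk_mem_prod hx.1 (hεW ht))
    exact (hasMFDerivAt_extChartAt_symm_comp h1 h2).hasMFDerivWithinAt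

theorem IsMIntegralCurveAt.contMDiffAt {γ : ℝ → M} {t₀ : ℝ}
    (hv : ContMDiff I I.tangent 1 (fun x ↦ (⟨x, v x⟩ : TangentBundle I M)))
    (hγ : IsMIntegralCurveAt γ v t₀) : ContMDiffAt 𝓘(ℝ, ℝ) I 1 γ t₀ := by
  obtain ⟨ψ, hψ, U, hU, ε, hε, h⟩ := exists_contMDiffAt_localFlow (hv (γ t₀))
  obtain ⟨h0, hcurve⟩ := h _ (mem_of_mem_nhds hU)
  have hcurve' : IsMIntegralCurveAt (fun t ↦ ψ (γ t₀, t - t₀)) v t₀ := by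
    have := (hcurve.comp_add (-t₀)).isMIntegralCurveAt (t₀ := t₀) (by
      refine (isOpen_Ioo.preimage (continuous_add_const (-t₀))).mem_nhds ?_
      simp [hε])
    simpa [Function.comp_def, ← sub_eq_add_neg] using this
  have heq := isMIntegralCurveAt_eventuallyEq_of_contMDiffAt_boundaryless (hv (γ t₀)) hγ hcurve'
    (by simp [h0])
  refine ContMDiffAt.congr_of_eventuallyEq ?_ heq
  have h1 : ContMDiffAt 𝓘(ℝ, ℝ) (I.prod 𝓘(ℝ, ℝ)) 1 (fun t ↦ (γ t₀, t - t₀)) t₀ :=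
    contMDiffAt_const.prodMk (contDiffAt_id.sub contDiffAt_const).contMDiffAt
  exact ContMDiffAt.comp t₀ (g := ψ) (by simpa using hψ) h1

theorem IsCompact.exists_uniform_isMIntegralCurveOn
    (hv : ContMDiff I I.tangent 1 (fun x ↦ (⟨x, v x⟩ : TangentBundle I M)))
    {K : Set M} (hK : IsCompact K) :
    ∃ ε > 0, ∀ x ∈ K, ∃ γ : ℝ → M, γ 0 = x ∧ IsMIntegralCurveOn γ v (Ioo (-ε) ε) := by
  refine hK.induction_on ⟨1, one_pos, by simp⟩ ?_ ?_ ?_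
  · rintro s t hst ⟨ε, hε, h⟩
    exact ⟨ε, hε, fun x hx ↦ h x (hst hx)⟩
  · rintro s t ⟨ε, hε, h⟩ ⟨δ, hδ, h'⟩
    refine ⟨min ε δ, lt_min hε hδ, ?_⟩
    rintro x (hx | hx)
    · obtain ⟨γ, h0, hγ⟩ := h x hx
      exact ⟨γ, h0, hγ.mono (Ioo_subset_Ioo (neg_le_neg (min_le_left _ _)) (min_le_left _ _))⟩
    · obtain ⟨γ, h0, hγ⟩ := h' x hx
      exact ⟨γ, h0, hγ.mono (Ioo_subset_Ioo (neg_le_neg (min_le_right _ _)) (min_le_right _ _))⟩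
  · intro x _
    obtain ⟨ψ, -, U, hU, ε, hε, h⟩ := exists_contMDiffAt_localFlow (hv x)
    exact ⟨U, mem_nhdsWithin_of_mem_nhds hU, ε, hε, fun y hy ↦ ⟨fun t ↦ ψ (y, t), h y hy⟩⟩

end ManifoldFlow

section GlobalFlow

variable {E : Type*} [NormedAddCommGroup E] [NormedSpace ℝ E]
  {H : Type*} [TopologicalSpace H] {I : ModelWithCorners ℝ E H}
  {M : Type*} [TopologicalSpace M] [ChartedSpace H M] [IsManifold I 1 M]
  [BoundarylessManifold I M] {v : (x : M) → TangentSpace I x}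

variable [T2Space M] {Φ : M × ℝ → M}

theorem map_add_of_isMIntegralCurve
    (hv : ContMDiff I I.tangent 1 (fun x ↦ (⟨x, v x⟩ : TangentBundle I M)))
    (h0 : ∀ x, Φ (x, 0) = x) (hΦ : ∀ x, IsMIntegralCurve (fun t ↦ Φ (x, t)) v) (x : M) (s t : ℝ) :
    Φ (x, s + t) = Φ (Φ (x, s), t) := by
  have h1 : IsMIntegralCurve (fun t ↦ Φ (x, t + s)) v := (hΦ x).comp_add s
  have h2 := isMIntegralCurve_Ioo_eq_of_contMDiff_boundaryless (t₀ := 0) hv h1 (hΦ (Φ (x, s)))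
    (by simp [h0])
  rw [add_comm]
  exact congrFun h2 t

variable [FiniteDimensional ℝ E]

/-- **Escape lemma**: if the integral curves starting at `x` stay in a compact set for bounded
times, then there is a global integral curve starting at `x`. -/
theorem exists_isMIntegralCurve_of_forall_mem_isCompact
    (hv : ContMDiff I I.tangent 1 (fun x ↦ (⟨x, v x⟩ : TangentBundle I M))) (x : M)
    (h : ∀ R, ∃ K : Set M, IsCompact K ∧ ∀ a ≤ R, ∀ γ : ℝ → M, γ 0 = x →
      IsMIntegralCurveOn γ v (Ioo (-a) a) → MapsTo γ (Ioo (-a) a) K) :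
    ∃ γ : ℝ → M, γ 0 = x ∧ IsMIntegralCurve γ v := by
  let s := {a | ∃ γ, γ 0 = x ∧ IsMIntegralCurveOn γ v (Ioo (-a) a)}
  suffices hbdd : ¬BddAbove s by
    rw [not_bddAbove_iff] at hbdd
    rw [exists_isMIntegralCurve_iff_exists_isMIntegralCurveOn_Ioo hv]
    intro a
    obtain ⟨y, ⟨γ, hγ1, hγ2⟩, hlt⟩ := hbdd a
    exact ⟨γ, hγ1, hγ2.mono <| Ioo_subset_Ioo (neg_le_neg hlt.le) hlt.le⟩
  intro hbdd
  set asup := sSup s with hasup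
  obtain ⟨K, hK, hKγ⟩ := h asup
  obtain ⟨ε, hε, hεK⟩ := hK.exists_uniform_isMIntegralCurveOn hv
  have hxK : x ∈ K := by
    obtain ⟨a, ha, hx⟩ := (isCompact_singleton (x := x)).exists_uniform_isMIntegralCurveOn hv
    obtain ⟨γ, hγ0, hγ⟩ := hx x rfl
    exact hγ0 ▸ hKγ a (le_csSup hbdd ⟨γ, hγ0, hγ⟩) γ hγ0 hγ ⟨neg_neg_of_pos ha, ha⟩
  have hεs : ε ∈ s := hεK x hxK
  have hεle : ε ≤ asup := le_csSup hbdd hεs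
  obtain ⟨a, ha, hlt⟩ := Real.add_neg_lt_sSup ⟨ε, hεs⟩ (ε := - (ε / 2))
    (by rw [neg_lt, neg_zero]; exact half_pos hε)
  rw [← hasup, ← sub_eq_add_neg] at hlt
  have hale : a ≤ asup := le_csSup hbdd ha
  obtain ⟨γ, h0, hγ⟩ := ha
  have hmaps := hKγ a hale γ h0 hγ
  obtain ⟨γ1_aux, h1_aux, hγ1⟩ := hεK (γ (-(asup - ε / 2)))
    (hmaps ⟨neg_lt_neg hlt, by linarith⟩)
  rw [← isMIntegralCurveOn_comp_add (dt := asup - ε / 2)] at hγ1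
  set γ1 := γ1_aux ∘ (· + (asup - ε / 2)) with γ1_def
  have heq1 : γ1 (-(asup - ε / 2)) = γ (-(asup - ε / 2)) := by simp [γ1_def, h1_aux]
  obtain ⟨γ2_aux, h2_aux, hγ2⟩ := hεK (γ (asup - ε / 2)) (hmaps ⟨by linarith, hlt⟩)
  rw [← isMIntegralCurveOn_comp_sub (dt := asup - ε / 2)] at hγ2
  set γ2 := γ2_aux ∘ (· - (asup - ε / 2)) with γ2_def
  have heq2 : γ2 (asup - ε / 2) = γ (asup - ε / 2) := by simp [γ2_def, h2_aux]
  simp_rw [Set.mem_Ioo, ← sub_lt_iff_lt_add, ← lt_sub_iff_add_lt, ← Set.mem_Ioo] at hγ1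
  simp_rw [Set.mem_Ioo, lt_sub_iff_add_lt, sub_lt_iff_lt_add, ← Set.mem_Ioo] at hγ2
  set γ_ext : ℝ → M := piecewise (Ioo (-(asup + ε / 2)) a)
    (piecewise (Ioo (-a) a) γ γ1) γ2 with γ_ext_def
  have heq_ext : γ_ext 0 = x := by
    rw [γ_ext_def, piecewise, if_pos ⟨by linarith, by linarith⟩, piecewise,
      if_pos ⟨by linarith, by linarith⟩, h0]
  suffices hext : IsMIntegralCurveOn γ_ext v (Ioo (-(asup + ε / 2)) (asup + ε / 2)) from
    (not_lt.mpr <| le_csSup hbdd ⟨γ_ext, heq_ext, hext⟩) <| lt_add_of_pos_right asup (half_pos hε)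
  apply (isMIntegralCurveOn_piecewise (t₀ := asup - ε / 2) hv _ hγ2
      ⟨⟨by linarith, hlt⟩, ⟨by linarith, by linarith⟩⟩
      (by rw [piecewise, if_pos ⟨by linarith, hlt⟩, ← heq2])).mono
    (Ioo_subset_Ioo_union_Ioo le_rfl (by linarith) (by linarith))
  exact (isMIntegralCurveOn_piecewise (t₀ := -(asup - ε / 2)) hv hγ hγ1
      ⟨⟨neg_lt_neg hlt, by linarith⟩, ⟨by linarith, by linarith⟩⟩ heq1.symm).mono
    (union_comm _ _ ▸ Ioo_subset_Ioo_union_Ioo (by linarith) (by linarith) le_rfl)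

theorem exists_contMDiffAt_of_isMIntegralCurve
    (hv : ContMDiff I I.tangent 1 (fun x ↦ (⟨x, v x⟩ : TangentBundle I M)))
    (h0 : ∀ x, Φ (x, 0) = x) (hΦ : ∀ x, IsMIntegralCurve (fun t ↦ Φ (x, t)) v) (x₀ : M) :
    ∃ U ∈ 𝓝 x₀, ∃ ε > 0, ∀ x ∈ U, ∀ t ∈ Ioo (-ε) ε,
      ContMDiffAt (I.prod 𝓘(ℝ, ℝ)) I 1 Φ (x, t) := by
  obtain ⟨ψ, hψ, U, hU, ε, hε, h⟩ := exists_contMDiffAt_localFlow (hv x₀)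
  have heq : Φ =ᶠ[𝓝 (x₀, 0)] ψ := by
    filter_upwards [prod_mem_nhds hU (Ioo_mem_nhds (neg_neg_of_pos hε) hε)] with p hp
    exact isMIntegralCurveOn_Ioo_eqOn_of_contMDiff_boundaryless (t₀ := 0)
      ⟨neg_neg_of_pos hε, hε⟩ hv ((hΦ p.1).isMIntegralCurveOn _) (h p.1 hp.1).2
      (by rw [h0, (h p.1 hp.1).1]) hp.2
  have hev := contMDiffAt_iff_contMDiffAt_nhds (by simp) |>.1 (hψ.congr_of_eventuallyEq heq)
  obtain ⟨V, hV, W, hW, hVW⟩ := mem_nhds_prod_iff.1 hev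
  obtain ⟨δ, hδ, hδW⟩ := Metric.mem_nhds_iff.1 hW
  rw [Real.ball_eq_Ioo, zero_sub, zero_add] at hδW
  exact ⟨V, hV, δ, hδ, fun x hx t ht ↦ hVW (mk_mem_prod hx (hδW ht))⟩

/-- The flow of a complete `C^1` vector field is `C^1`. -/
theorem contMDiff_of_isMIntegralCurve
    (hv : ContMDiff I I.tangent 1 (fun x ↦ (⟨x, v x⟩ : TangentBundle I M)))
    (h0 : ∀ x, Φ (x, 0) = x) (hΦ : ∀ x, IsMIntegralCurve (fun t ↦ Φ (x, t)) v) :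
    ContMDiff (I.prod 𝓘(ℝ, ℝ)) I 1 Φ := by
  have step {x : M} {t s : ℝ} (ht : ContMDiffAt (I.prod 𝓘(ℝ, ℝ)) I 1 Φ (x, t))
      (hs : ContMDiffAt (I.prod 𝓘(ℝ, ℝ)) I 1 Φ (Φ (x, t), s - t)) :
      ContMDiffAt (I.prod 𝓘(ℝ, ℝ)) I 1 Φ (x, s) := by
    have heq : Φ = fun p ↦ Φ (Φ (p.1, t), p.2 - t) := by
      ext p
      rw [← map_add_of_isMIntegralCurve hv h0 hΦ, add_sub_cancel]
    rw [heq]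
    have h1 : ContMDiffAt (I.prod 𝓘(ℝ, ℝ)) I 1 (fun p : M × ℝ ↦ Φ (p.1, t)) (x, s) :=
      ContMDiffAt.comp (x, s) (g := Φ) (f := fun p : M × ℝ ↦ (p.1, t)) ht
        (contMDiffAt_fst.prodMk contMDiffAt_const)
    have h2 : ContMDiffAt (I.prod 𝓘(ℝ, ℝ)) 𝓘(ℝ, ℝ) 1 (fun p : M × ℝ ↦ p.2 - t) (x, s) :=
      contMDiffAt_snd.sub contMDiffAt_const
    exact ContMDiffAt.comp (x, s) (g := Φ) hs (h1.prodMk h2)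
  rintro ⟨x, t⟩
  have huniv : {t | ContMDiffAt (I.prod 𝓘(ℝ, ℝ)) I 1 Φ (x, t)} = univ := by
    refine IsClopen.eq_univ ⟨isClosed_of_closure_subset fun t ht ↦ ?_,
      isOpen_iff_mem_nhds.2 fun t ht ↦ ?_⟩ ⟨0, ?_⟩
    · obtain ⟨U, hU, ε, hε, h⟩ := exists_contMDiffAt_of_isMIntegralCurve hv h0 hΦ (Φ (x, t))
      have hnear : ∀ᶠ s in 𝓝 t, Φ (x, s) ∈ U ∧ t - s ∈ Ioo (-ε) ε := by
        refine Eventually.and ((hΦ x).continuous.continuousAt.preimage_mem_nhds hU) ?_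
        refine (continuous_const.sub continuous_id).continuousAt.preimage_mem_nhds
          (Ioo_mem_nhds ?_ ?_) <;> simp [hε]
      obtain ⟨s, hs, hsU, hst⟩ := ((mem_closure_iff_frequently.1 ht).and_eventually hnear).exists
      exact step hs (h _ hsU _ hst)
    · obtain ⟨U, hU, ε, hε, h⟩ := exists_contMDiffAt_of_isMIntegralCurve hv h0 hΦ (Φ (x, t))
      have hnear : ∀ᶠ s in 𝓝 t, s - t ∈ Ioo (-ε) ε := by
        refine (continuous_id.sub continuous_const).continuousAt.preimage_mem_nhds
          (Ioo_mem_nhds ?_ ?_) <;> simp [hε]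
      filter_upwards [hnear] with s hs
      exact step ht (h _ (mem_of_mem_nhds hU) _ hs)
    · obtain ⟨U, hU, ε, hε, h⟩ := exists_contMDiffAt_of_isMIntegralCurve hv h0 hΦ x
      exact h x (mem_of_mem_nhds hU) 0 ⟨neg_neg_of_pos hε, hε⟩
  exact huniv.ge (mem_univ t)

end GlobalFlow

section Suspension

variable {E : Type*} [NormedAddCommGroup E] [NormedSpace ℝ E]
  {H : Type*} [TopologicalSpace H] {I : ModelWithCorners ℝ E H}
  {M : Type*} [TopologicalSpace M] [ChartedSpace H M]
  {f : (z : M) → ℝ → TangentSpace I z}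

/-- The autonomous vector field `(f, 1)` on `M × ℝ` attached to a time-dependent vector field. -/
def suspension (f : (z : M) → ℝ → TangentSpace I z) (p : M × ℝ) :
    TangentSpace (I.prod 𝓘(ℝ, ℝ)) p :=
  ((f p.1 p.2, (1 : ℝ)) : E × ℝ)

theorem contMDiff_suspension [IsManifold I 1 M] (hf : IsC1TimeDependentField I f) :
    ContMDiff (I.prod 𝓘(ℝ, ℝ)) (I.prod 𝓘(ℝ, ℝ)).tangent 1
      (fun p ↦ (⟨p, suspension f p⟩ : TangentBundle (I.prod 𝓘(ℝ, ℝ)) (M × ℝ))) := by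
  have h1 : ContMDiff 𝓘(ℝ, ℝ) 𝓘(ℝ, ℝ).tangent 1
      (fun t : ℝ ↦ (⟨t, (1 : ℝ)⟩ : TangentBundle 𝓘(ℝ, ℝ) ℝ)) :=
    contMDiff_vectorSpace_iff_contDiff.2 contDiff_const
  exact contMDiff_equivTangentBundleProd_symm.comp (ContMDiff.prodMk hf (h1.comp contMDiff_snd))

theorem hasMFDerivAt_fst_of_suspension {γ : ℝ → M × ℝ} {t : ℝ}
    (h : HasMFDerivAt 𝓘(ℝ, ℝ) (I.prod 𝓘(ℝ, ℝ)) γ t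
      ((1 : ℝ →L[ℝ] ℝ).smulRight (suspension f (γ t)))) :
    HasMFDerivAt 𝓘(ℝ, ℝ) I (fun t ↦ (γ t).1) t
      ((1 : ℝ →L[ℝ] ℝ).smulRight (f (γ t).1 (γ t).2)) :=
  (HasMFDerivAt.comp t (hasMFDerivAt_fst (γ t)) h).congr_mfderiv rfl

theorem hasDerivAt_snd_of_suspension {γ : ℝ → M × ℝ} {t : ℝ}
    (h : HasMFDerivAt 𝓘(ℝ, ℝ) (I.prod 𝓘(ℝ, ℝ)) γ t
      ((1 : ℝ →L[ℝ] ℝ).smulRight (suspension f (γ t)))) :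
    HasDerivAt (fun t ↦ (γ t).2) 1 t := by
  have h1 : HasFDerivAt (fun t ↦ (γ t).2) ((1 : ℝ →L[ℝ] ℝ).smulRight (1 : ℝ)) t :=
    hasMFDerivAt_iff_hasFDerivAt.1
      ((HasMFDerivAt.comp t (hasMFDerivAt_snd (γ t)) h).congr_mfderiv rfl)
  simpa using h1.hasDerivAt

theorem SolvesOn.isMIntegralCurveOn {γ : ℝ → M} {J : Set ℝ} (h : SolvesOn I f γ J) :
    IsMIntegralCurveOn (fun t ↦ (γ t, t)) (suspension f) J := fun t ht ↦ by
  refine HasMFDerivAt.hasMFDerivWithinAt ?_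
  refine ((h t ht).prodMk (hasMFDerivAt_id t)).congr_mfderiv ?_
  exact ContinuousLinearMap.ext fun x : ℝ ↦ Prod.ext rfl (mul_one (x : ℝ)).symm

theorem IsMIntegralCurveOn.snd_sub_snd_eq {γ : ℝ → M × ℝ} {a b s t : ℝ}
    (h : IsMIntegralCurveOn γ (suspension f) (Ioo a b)) (hs : s ∈ Ioo a b) (ht : t ∈ Ioo a b) :
    (γ t).2 - (γ s).2 = t - s := by
  have hd (x : ℝ) (hx : x ∈ Ioo a b) :
      HasDerivWithinAt (fun t ↦ (γ t).2 - t) 0 (Ioo a b) x := by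
    have := (hasDerivAt_snd_of_suspension
      ((h x hx).hasMFDerivAt (isOpen_Ioo.mem_nhds hx))).sub (hasDerivAt_id x)
    exact (this.congr_deriv (sub_self 1)).hasDerivWithinAt
  have := (convex_Ioo a b).norm_image_sub_le_of_norm_hasDerivWithin_le (C := 0) hd
    (by simp) hs ht
  rw [zero_mul, norm_le_zero_iff] at this
  linarith

end Suspension

section Riemannian

variable {E : Type*} [NormedAddCommGroup E] [NormedSpace ℝ E]
  {H : Type*} [TopologicalSpace H] {I : ModelWithCorners ℝ E H}
  {M : Type*} [EMetricSpace M] [ChartedSpace H M]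
  [Bundle.RiemannianBundle (fun z : M ↦ TangentSpace I z)]
  [IsRiemannianManifold I M]

/-- A curve of speed at most `c` is `c`-Lipschitz for the Riemannian distance. -/
theorem edist_le_of_norm_mfderiv_le {γ : ℝ → M} {s t c : ℝ} (hst : s ≤ t)
    (hγ : ContMDiffOn 𝓘(ℝ, ℝ) I 1 γ (Icc s t))
    (hc : ∀ τ ∈ Ioo s t, ‖mfderiv 𝓘(ℝ, ℝ) I γ τ (1 : ℝ)‖ ≤ c) :
    edist (γ s) (γ t) ≤ ENNReal.ofReal (c * (t - s)) := by
  refine (edist_le_pathELength hγ le_rfl hst le_rfl).trans ?_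
  rw [pathELength_eq_lintegral_mfderiv_Ioo]
  calc ∫⁻ τ in Ioo s t, ‖mfderiv 𝓘(ℝ, ℝ) I γ τ (1 : ℝ)‖ₑ
      ≤ ∫⁻ _ in Ioo s t, ENNReal.ofReal c := by
        refine setLIntegral_mono' measurableSet_Ioo fun τ hτ ↦ ?_
        rw [← ofReal_norm]
        exact ENNReal.ofReal_le_ofReal (hc τ hτ)
    _ = ENNReal.ofReal (c * (t - s)) := by
        rw [setLIntegral_const, Real.volume_Ioo, ENNReal.ofReal_mul' (sub_nonneg.2 hst)]

variable [FiniteDimensional ℝ E] [IsManifold I 1 M] [BoundarylessManifold I M]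
  {f : (z : M) → ℝ → TangentSpace I z}

theorem IsMIntegralCurveOn.edist_fst_le (hf : IsC1TimeDependentField I f) {c : ℝ}
    (hc : ∀ z t, ‖f z t‖ ≤ c) {γ : ℝ → M × ℝ} {a b s t : ℝ}
    (h : IsMIntegralCurveOn γ (suspension f) (Ioo a b)) (hs : a < s) (hst : s ≤ t) (ht : t < b) :
    edist (γ s).1 (γ t).1 ≤ ENNReal.ofReal (c * (t - s)) := by
  have hsub : Icc s t ⊆ Ioo a b := Icc_subset_Ioo hs ht
  refine edist_le_of_norm_mfderiv_le (I := I) (γ := fun t ↦ (γ t).1) hst (fun τ hτ ↦ ?_)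
    fun τ hτ ↦ ?_
  · have h1 := (h.isMIntegralCurveAt (isOpen_Ioo.mem_nhds (hsub hτ))).contMDiffAt
      (contMDiff_suspension hf)
    exact (ContMDiffAt.comp τ contMDiffAt_fst h1).contMDiffWithinAt
  · have hτ' := hsub (Ioo_subset_Icc_self hτ)
    rw [(hasMFDerivAt_fst_of_suspension
      ((h τ hτ').hasMFDerivAt (isOpen_Ioo.mem_nhds hτ'))).mfderiv]
    refine (congrArg norm ?_).trans_le (hc (γ τ).1 (γ τ).2)
    exact one_smul ℝ (f (γ τ).1 (γ τ).2)

/-- The suspension of a bounded `C^1` time-dependent vector field is complete as soon as closed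
balls are compact. -/
theorem exists_isMIntegralCurve_suspension (hf : IsC1TimeDependentField I f) {c : ℝ}
    (hc : ∀ z t, ‖f z t‖ ≤ c)
    (hcompact : ∀ (p : M) (R : ℝ), IsCompact (Metric.closedEBall p (ENNReal.ofReal R)))
    (w : M × ℝ) : ∃ γ : ℝ → M × ℝ, γ 0 = w ∧ IsMIntegralCurve γ (suspension f) := by
  have hc0 : 0 ≤ c := (norm_nonneg _).trans (hc w.1 0)
  refine exists_isMIntegralCurve_of_forall_mem_isCompact (contMDiff_suspension hf) w fun R ↦
    ⟨Metric.closedEBall w.1 (ENNReal.ofReal (c * R)) ×ˢ Icc (w.2 - R) (w.2 + R),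
      (hcompact _ _).prod isCompact_Icc, fun a ha γ h0 hγ t ht ↦ ⟨?_, ?_⟩⟩
  · have habs : |t| ≤ R := (abs_lt.2 ht).le.trans ha
    refine le_trans ?_ (ENNReal.ofReal_le_ofReal (mul_le_mul_of_nonneg_left habs hc0))
    have hpos : 0 < a := by linarith [ht.1, ht.2]
    rw [← h0]
    rcases le_total 0 t with h | h
    · rw [edist_comm, abs_of_nonneg h]
      simpa using hγ.edist_fst_le hf hc (neg_neg_of_pos hpos) h ht.2
    · rw [abs_of_nonpos h]
      simpa using hγ.edist_fst_le hf hc ht.1 h hpos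
  · have hpos : 0 < a := by linarith [ht.1, ht.2]
    have := hγ.snd_sub_snd_eq ⟨neg_neg_of_pos hpos, hpos⟩ ht
    rw [h0] at this
    constructor <;> linarith [ht.1, ht.2]

end Riemannian

theorem proposition1
    {E : Type*} [NormedAddCommGroup E] [NormedSpace ℝ E] [FiniteDimensional ℝ E]
    {H : Type*} [TopologicalSpace H] (I : ModelWithCorners ℝ E H) [I.Boundaryless]
    {M : Type*} [EMetricSpace M] [ChartedSpace H M] [IsManifold I ∞ M]
    [Bundle.RiemannianBundle (fun z : M ↦ TangentSpace I z)]
    [IsContMDiffRiemannianBundle I ∞ E (fun z : M ↦ TangentSpace I z)]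
    [IsRiemannianManifold I M]
    (hM : GeodesicallyComplete M)
    (f : (z : M) → ℝ → TangentSpace I z)
    (hf : IsC1TimeDependentField I f)
    (hbdd : ∃ c : ℝ, ∀ (z : M) (t : ℝ), ‖f z t‖ ≤ c) :
    ∃ φ : M × ℝ → M,
      IsGlobalFlow I f φ ∧
      (∀ (γ : ℝ → M) (J : Set ℝ), IsOpen J → J.OrdConnected → (0 : ℝ) ∈ J →
        SolvesOn I f γ J → Set.EqOn γ (fun t ↦ φ (γ 0, t)) J) ∧
      ∀ t : ℝ, ∃ Φ : M ≃ₘ^1⟮I, I⟯ M, ∀ z, Φ z = φ (z, t) := by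
  obtain ⟨c, hc⟩ := hbdd
  have : LocallyCompactSpace M := Manifold.locallyCompact_of_finiteDimensional I
  have hcompact := (hasAlmostGeodesics_of_isRiemannianManifold I M).isCompact_closedEBall hM
  have hV := contMDiff_suspension hf
  choose Γ hΓ0 hΓ using exists_isMIntegralCurve_suspension hf hc hcompact
  let Ψ : (M × ℝ) × ℝ → M × ℝ := fun p ↦ Γ p.1 p.2
  have hΨ : ContMDiff ((I.prod 𝓘(ℝ, ℝ)).prod 𝓘(ℝ, ℝ)) (I.prod 𝓘(ℝ, ℝ)) 1 Ψ :=
    contMDiff_of_isMIntegralCurve hV hΓ0 hΓ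
  have hadd (w : M × ℝ) (s t : ℝ) : Γ w (s + t) = Γ (Γ w s) t :=
    map_add_of_isMIntegralCurve (Φ := Ψ) hV hΓ0 hΓ w s t
  have hsnd (w : M × ℝ) (t : ℝ) : (Γ w t).2 = w.2 + t := by
    have ht : t ∈ Ioo (-(|t| + 1)) (|t| + 1) := abs_lt.1 (lt_add_one _)
    have h0 : (0 : ℝ) ∈ Ioo (-(|t| + 1)) (|t| + 1) := abs_lt.1 (by rw [abs_zero]; positivity)
    have := ((hΓ w).isMIntegralCurveOn _).snd_sub_snd_eq h0 ht
    rw [hΓ0] at this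
    linarith
  have hsmooth {r : M → ℝ} {s : ℝ} (hr : ContMDiff I 𝓘(ℝ, ℝ) 1 r) :
      ContMDiff I I 1 (fun z ↦ (Γ (z, r z) s).1) :=
    contMDiff_fst.comp (hΨ.comp ((contMDiff_id.prodMk hr).prodMk contMDiff_const))
  refine ⟨fun p ↦ (Γ (p.1, 0) p.2).1, ⟨?_, fun z ↦ by simp [hΓ0], fun z t _ ↦ ?_⟩, ?_, fun t ↦ ?_⟩
  · exact contMDiff_fst.comp (hΨ.comp
      ((contMDiff_fst.prodMk contMDiff_const).prodMk contMDiff_snd))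
  · have := hasMFDerivAt_fst_of_suspension (hΓ (z, 0) t)
    rwa [hsnd, zero_add] at this
  · intro γ J hJ hJc h0 hγ t ht
    obtain ⟨a, b, ha, hb, hab⟩ : ∃ a b, 0 ∈ Ioo a b ∧ t ∈ Ioo a b ∧ Ioo a b ⊆ J := by
      obtain ⟨δ, hδ, hδJ⟩ := Metric.isOpen_iff.1 hJ _ h0
      obtain ⟨η, hη, hηJ⟩ := Metric.isOpen_iff.1 hJ _ ht
      rw [Real.ball_eq_Ioo] at hδJ hηJ
      have hunion : Ioo (min (0 - δ) (t - η)) (max (0 + δ) (t + η)) ⊆ J := by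
        intro x hx
        rw [mem_Ioo, min_lt_iff, lt_max_iff] at hx
        by_cases h1 : x ∈ Ioo (0 - δ) (0 + δ)
        · exact hδJ h1
        by_cases h2 : x ∈ Ioo (t - η) (t + η)
        · exact hηJ h2
        refine hJc.uIcc_subset h0 ht ?_
        rw [mem_uIcc]
        grind
      exact ⟨_, _, by simp [hδ], by simp [hη], hunion⟩
    have := isMIntegralCurveOn_Ioo_eqOn_of_contMDiff_boundaryless ha hV
      (hγ.isMIntegralCurveOn.mono hab) ((hΓ (γ 0, 0)).isMIntegralCurveOn _) (by simp [hΓ0]) hb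
    exact congrArg Prod.fst this
  · refine ⟨⟨⟨fun z ↦ (Γ (z, 0) t).1, fun z ↦ (Γ (z, t) (-t)).1, fun z ↦ ?_, fun z ↦ ?_⟩,
      hsmooth contMDiff_const, hsmooth contMDiff_const⟩, fun z ↦ rfl⟩
    · have h1 : ((Γ (z, 0) t).1, t) = Γ (z, 0) t := Prod.ext rfl (by simp [hsnd])
      simp only [h1, ← hadd, add_neg_cancel, hΓ0]
    · have h1 : ((Γ (z, t) (-t)).1, (0 : ℝ)) = Γ (z, t) (-t) := Prod.ext rfl (by simp [hsnd])
      simp only [h1, ← hadd, neg_add_cancel, hΓ0]
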